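/- Consider the square lattice $\mathbb{Z}^2$, i.e. the graph with vertex set $\mathbb{Z}^2$ whose edges join the pairs $v, v+(1,0)$ and $v, v+(0,1)$. An edge percolation measure on $\mathbb{Z}^2$ is a probability measure $\mu$ on $\{0,1\}^{E(\mathbb{Z}^2)}$ with the product $\sigma$-algebra; an edge $e$ is open in a configuration $\omega$ if $\omega_e=1$, and the clusters of $\omega$ are the connected components of the graph formed by all vertices and the open edges. The measure $\mu$ is translation-invariant if it is invariant under the action of $\mathbb{Z}^2$ on $\{0,1\}^{E(\mathbb{Z}^2)}$ by translations. Let $\mu_{\mathrm{hp}}$ be the marginal of $\mu$ on the upper half-plane $\mathbb{Z}\times\mathbb{Z}_{\ge 0}$, i.e. the law of the restriction of $\omega$ to the edges with both endpoints in $\mathbb{Z}\times\mathbb{Z}_{\ge 0}$; its clusters are the connected components of the graph on $\mathbb{Z}\times\mathbb{Z}_{\ge 0}$ formed by the open edges among these. **Lemma 2.3.** Let $\mu$ be a translation-invariant edge percolation measure on $\mathbb{Z}^2$ that almost surely has only finitely many infinite clusters. Then $\mu_{\mathrm{hp}}$ almost surely has at most $1$ infinite cluster. -/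

import Mathlib

open MeasureTheory

namespace Percolation

/-- The square lattice: the Cayley graph of `ℤ × ℤ` with respect to `(1, 0)` and `(0, 1)`. -/
def squareLattice : SimpleGraph (ℤ × ℤ) where
  Adj u v := v - u = (1, 0) ∨ v - u = (0, 1) ∨ u - v = (1, 0) ∨ u - v = (0, 1)
  symm := ⟨fun _ _ h => by tauto⟩
  loopless := ⟨fun u h => by simp [Prod.ext_iff] at h⟩

/-- The upper half-plane `ℤ × ℤ_{≥ 0}`, as a set of vertices. -/
def upperHalfPlane : Set (ℤ × ℤ) := {v | 0 ≤ v.2}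

/-- The square lattice on the upper half-plane: all lattice edges with both endpoints in it. -/
def halfPlaneLattice : SimpleGraph upperHalfPlane := squareLattice.induce upperHalfPlane

/-- Edge configurations on `G`: `true` is open, `false` is closed. As a function type this carries
the product σ-algebra. -/
abbrev Config {V : Type} (G : SimpleGraph V) : Type := G.edgeSet → Bool

/-- The subgraph of `G` on all vertices whose edges are the open edges of `ω`. -/
def openGraph {V : Type} {G : SimpleGraph V} (ω : Config G) : SimpleGraph V where
  Adj u v := ∃ h : G.Adj u v, ω ⟨s(u, v), h⟩ = true
  symm := ⟨fun u v ⟨h, hω⟩ => ⟨h.symm, by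
    have e : (⟨s(v, u), h.symm⟩ : G.edgeSet) = ⟨s(u, v), h⟩ := Subtype.ext Sym2.eq_swap
    rw [e]; exact hω⟩⟩
  loopless := ⟨fun u ⟨h, _⟩ => G.loopless.irrefl u h⟩

/-- The infinite clusters of `ω`: the connected components of the open subgraph that have
infinitely many vertices. -/
def infiniteClusters {V : Type} {G : SimpleGraph V} (ω : Config G) :
    Set (openGraph ω).ConnectedComponent :=
  {C | C.supp.Infinite}

/-- Translation by `a`, as an automorphism of the square lattice. -/
def translateIso (a : ℤ × ℤ) : squareLattice ≃g squareLattice where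
  toEquiv := Equiv.addRight a
  map_rel_iff' := by intro u v; simp [squareLattice]

/-- Translation of configurations by `a`: the state of `e` becomes the state of `e - a`. -/
def translate (a : ℤ × ℤ) (ω : Config squareLattice) : Config squareLattice :=
  fun e => ω ((translateIso a).symm.mapEdgeSet e)

theorem measurable_translate (a : ℤ × ℤ) : Measurable (translate a) :=
  measurable_pi_lambda _ fun _ => measurable_pi_apply _

/-- Invariance of a measure on configurations under all translations in `ℤ × ℤ`. -/
def TranslationInvariant (μ : Measure (Config squareLattice)) : Prop :=
  ∀ a : ℤ × ℤ, μ.map (translate a) = μ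

/-- The inclusion of the half-plane edges into the edges of the square lattice. -/
def halfPlaneEdge : halfPlaneLattice.edgeSet → squareLattice.edgeSet :=
  (SimpleGraph.Embedding.induce upperHalfPlane : halfPlaneLattice ↪g squareLattice).mapEdgeSet

/-- Restriction of a configuration to the edges of the upper half-plane. -/
def restrictHalfPlane (ω : Config squareLattice) : Config halfPlaneLattice :=
  fun e => ω (halfPlaneEdge e)

theorem measurable_restrictHalfPlane : Measurable restrictHalfPlane :=
  measurable_pi_lambda _ fun _ => measurable_pi_apply _

/-- The marginal of `μ` on the upper half-plane. -/
noncomputable def halfPlaneMarginal (μ : Measure (Config squareLattice)) :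
    Measure (Config halfPlaneLattice) :=
  μ.map restrictHalfPlane

end Percolation

/-! Infinite clusters of the half-plane have zero density along its boundary. Suppose the mean
number of them meeting `n` consecutive boundary vertices is at least `n * c` for all `n`. By
invariance the same holds on row `-m` for the half-plane above `-m`. Such a cluster meeting the
bottom of a box of height `m` exits through the top, on row `0`, or through one of the sides, which
have `2 * (m + 1)` vertices in all. Lengthening the box with `m` fixed makes the sides negligible,
so the bound passes to row `0`; letting `m` grow, it passes to the clusters of the whole plane.
Almost surely these are finitely many, so `c = 0` (`eq_zero_of_mul_le_meanCount`).

A cluster has at most one rightmost and one leftmost boundary vertex, so almost surely no infinite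
half-plane cluster has either (`measure_extremalEvent`). Nor does an infinite plane cluster have a
lowest row (`measure_lowestRowEvent`), so every infinite half-plane cluster reaches the boundary.
Two such clusters therefore interlace along the boundary, and planarity makes them equal
(`reachable_of_interlaced`). -/

namespace Percolation

/-! ### Counting infinite clusters that meet a set -/

section Graph

variable {V : Type} {G G' : SimpleGraph V}

/-- The number of infinite connected components of `G` that meet `T`. -/
noncomputable def clusterCount (G : SimpleGraph V) (T : Set V) : ℕ :=
  (G.connectedComponentMk '' T ∩ {C | C.supp.Infinite}).ncard

theorem supp_infinite_congr {u v : V} (h : G.Reachable u v) :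
    (G.connectedComponentMk u).supp.Infinite ↔ (G.connectedComponentMk v).supp.Infinite := by
  rw [SimpleGraph.ConnectedComponent.eq.2 h]

theorem supp_infinite_iff {v : V} :
    (G.connectedComponentMk v).supp.Infinite ↔ ∀ F : Finset V, ∃ w ∉ F, G.Reachable v w := by
  constructor
  · intro h F
    obtain ⟨w, hw, hF⟩ := h.exists_notMem_finset F
    exact ⟨w, hF, (SimpleGraph.ConnectedComponent.exact hw).symm⟩
  · intro h hfin
    obtain ⟨w, hF, hw⟩ := h hfin.toFinset
    exact hF (hfin.mem_toFinset.2 (SimpleGraph.ConnectedComponent.sound hw.symm))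

theorem supp_infinite_of_reachable_imp {V' : Type} {G' : SimpleGraph V'} {f : V → V'}
    (hf : f.Injective) {v : V} (h : ∀ w, G.Reachable v w → G'.Reachable (f v) (f w))
    (hv : (G.connectedComponentMk v).supp.Infinite) :
    (G'.connectedComponentMk (f v)).supp.Infinite := by
  refine (hv.image hf.injOn).mono ?_
  rintro _ ⟨w, hw, rfl⟩
  exact SimpleGraph.ConnectedComponent.sound
    (h w (SimpleGraph.ConnectedComponent.exact hw).symm).symm

theorem clusterCount_le_ncard {T : Set V} (hT : T.Finite) : clusterCount G T ≤ T.ncard :=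
  (Set.ncard_le_ncard Set.inter_subset_left (hT.image _)).trans (Set.ncard_image_le hT)

theorem clusterCount_union_le (T T' : Set V) :
    clusterCount G (T ∪ T') ≤ clusterCount G T + clusterCount G T' := by
  unfold clusterCount
  rw [Set.image_union, Set.union_inter_distrib_right]
  exact Set.ncard_union_le _ _

theorem clusterCount_le_of_forall {T T' : Set V} (hT' : T'.Finite)
    (h : ∀ v ∈ T, (G.connectedComponentMk v).supp.Infinite → ∃ w ∈ T', G.Reachable v w) :
    clusterCount G T ≤ clusterCount G T' := by
  refine Set.ncard_le_ncard ?_ ((hT'.image _).inter_of_left _)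
  rintro _ ⟨⟨v, hv, rfl⟩, hinf⟩
  obtain ⟨w, hw, hvw⟩ := h v hv hinf
  exact ⟨⟨w, hw, SimpleGraph.ConnectedComponent.sound hvw.symm⟩, hinf⟩

theorem clusterCount_mono {T T' : Set V} (hT' : T'.Finite) (h : T ⊆ T') :
    clusterCount G T ≤ clusterCount G T' :=
  clusterCount_le_of_forall hT' fun v hv _ => ⟨v, h hv, .refl _⟩

/-- Each component of `G` lies in a component of `G'`; by `h` no two of those meeting `T` merge. -/
theorem clusterCount_le_of_le (hG : G ≤ G') {T : Set V} (hT : T.Finite)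
    (h : ∀ u ∈ T, ∀ v ∈ T, G'.Reachable u v → G.Reachable u v) :
    clusterCount G T ≤ clusterCount G' T := by
  refine Set.ncard_le_ncard_of_injOn
    (SimpleGraph.ConnectedComponent.map (SimpleGraph.Hom.ofLE hG)) ?_ ?_
    ((hT.image _).inter_of_left _)
  · rintro _ ⟨⟨v, hv, rfl⟩, hinf⟩
    exact ⟨⟨v, hv, rfl⟩, supp_infinite_of_reachable_imp (f := id) Function.injective_id
      (fun w hw => hw.mono hG) hinf⟩
  · rintro _ ⟨⟨u, hu, rfl⟩, -⟩ _ ⟨⟨v, hv, rfl⟩, -⟩ huv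
    exact SimpleGraph.ConnectedComponent.sound
      (h u hu v hv (SimpleGraph.ConnectedComponent.exact huv))

theorem supp_infinite_iso_iff {V' : Type} {G' : SimpleGraph V'} (φ : G ≃g G') {v : V} :
    (G'.connectedComponentMk (φ v)).supp.Infinite ↔ (G.connectedComponentMk v).supp.Infinite := by
  constructor
  · intro h
    have := supp_infinite_of_reachable_imp (f := φ.symm) φ.symm.injective
      (fun w hw => (SimpleGraph.Iso.reachable_iff (φ := φ.symm)).2 hw) h
    simpa using this
  · exact supp_infinite_of_reachable_imp (f := φ) φ.injective
      (fun w hw => (SimpleGraph.Iso.reachable_iff (φ := φ)).2 hw)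

theorem clusterCount_image_iso {V' : Type} {G' : SimpleGraph V'} (φ : G ≃g G') (T : Set V) :
    clusterCount G' (φ '' T) = clusterCount G T := by
  unfold clusterCount
  rw [← Set.ncard_image_of_injective _ φ.connectedComponentEquiv.injective]
  congr 1
  ext C
  constructor
  · rintro ⟨⟨_, ⟨v, hv, rfl⟩, rfl⟩, hinf⟩
    exact ⟨G.connectedComponentMk v, ⟨⟨v, hv, rfl⟩, (supp_infinite_iso_iff φ).1 hinf⟩, rfl⟩
  · rintro ⟨_, ⟨⟨v, hv, rfl⟩, hinf⟩, rfl⟩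
    exact ⟨⟨φ v, ⟨v, hv, rfl⟩, rfl⟩, (supp_infinite_iso_iff φ).2 hinf⟩

theorem ncard_le_clusterCount {A T : Set V} (hT : T.Finite) (hA : A ⊆ T)
    (hinf : ∀ v ∈ A, (G.connectedComponentMk v).supp.Infinite)
    (hsep : ∀ u ∈ A, ∀ v ∈ A, G.Reachable u v → u = v) : A.ncard ≤ clusterCount G T :=
  Set.ncard_le_ncard_of_injOn G.connectedComponentMk
    (fun v hv => ⟨⟨v, hA hv, rfl⟩, hinf v hv⟩)
    (fun u hu v hv huv => hsep u hu v hv (SimpleGraph.ConnectedComponent.exact huv))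
    ((hT.image _).inter_of_left _)

-- Writes the count as a sum of indicators, which gives its measurability by induction on `T`.
open Classical in
theorem clusterCount_insert {T : Set V} (hT : T.Finite) (v : V) :
    clusterCount G (insert v T) = clusterCount G T +
      if (G.connectedComponentMk v).supp.Infinite ∧ ∀ w ∈ T, ¬ G.Reachable w v then 1 else 0 := by
  have hmem : G.connectedComponentMk v ∈ G.connectedComponentMk '' T ↔
      ∃ w ∈ T, G.Reachable w v := by
    simp only [Set.mem_image, SimpleGraph.ConnectedComponent.eq]
  unfold clusterCount
  rw [Set.image_insert_eq]
  split_ifs with h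
  · rw [Set.insert_inter_of_mem h.1, Set.ncard_insert_of_notMem _ ((hT.image _).inter_of_left _)]
    rintro ⟨h1, -⟩
    obtain ⟨w, hw, hwv⟩ := hmem.1 h1
    exact h.2 w hw hwv
  · rw [add_zero]
    congr 1
    by_cases hv : (G.connectedComponentMk v).supp.Infinite
    · have : ∃ w ∈ T, G.Reachable w v := by
        by_contra hcon
        push Not at hcon
        exact h ⟨hv, hcon⟩
      rw [Set.insert_eq_of_mem (hmem.2 this)]
    · rw [Set.insert_inter_of_notMem hv]

end Graph

/-! ### Measurability of connectivity and of cluster counts -/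

section Measurability

variable {V Ω : Type} [Countable V] [MeasurableSpace Ω] {G : Ω → SimpleGraph V}

theorem measurableSet_reachable (hG : ∀ u v, MeasurableSet {ω | (G ω).Adj u v}) (u v : V) :
    MeasurableSet {ω | (G ω).Reachable u v} := by
  have hlen : ∀ n u, MeasurableSet {ω | ∃ p : (G ω).Walk u v, p.length = n} := by
    intro n
    induction n with
    | zero =>
      intro u
      have : {ω | ∃ p : (G ω).Walk u v, p.length = 0} = {_ω | u = v} := by
        ext ω
        exact SimpleGraph.Walk.exists_length_eq_zero_iff
      rw [this]
      exact .const _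
    | succ n ih =>
      intro u
      have : {ω | ∃ p : (G ω).Walk u v, p.length = n + 1} =
          ⋃ w, {ω | (G ω).Adj u w} ∩ {ω | ∃ p : (G ω).Walk w v, p.length = n} := by
        ext ω
        simp only [Set.mem_ofPred_eq, Set.mem_iUnion, Set.mem_inter_iff]
        constructor
        · rintro ⟨p, hp⟩
          cases p with
          | nil => simp at hp
          | cons h q => exact ⟨_, h, q, by simpa using hp⟩
        · rintro ⟨w, h, q, hq⟩
          exact ⟨.cons h q, by simp [hq]⟩
      rw [this]
      exact .iUnion fun w => (hG u w).inter (ih w)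
  have : {ω | (G ω).Reachable u v} = ⋃ n, {ω | ∃ p : (G ω).Walk u v, p.length = n} := by
    ext ω
    simp only [Set.mem_ofPred_eq, Set.mem_iUnion]
    exact ⟨fun ⟨p⟩ => ⟨_, p, rfl⟩, fun ⟨_, p, _⟩ => ⟨p⟩⟩
  rw [this]
  exact .iUnion fun n => hlen n u

theorem measurableSet_supp_infinite (hG : ∀ u v, MeasurableSet {ω | (G ω).Adj u v}) (v : V) :
    MeasurableSet {ω | ((G ω).connectedComponentMk v).supp.Infinite} := by
  simp only [supp_infinite_iff, Set.ofPred_forall, Set.ofPred_exists]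
  exact .iInter fun F => .iUnion fun w => (MeasurableSet.const (w ∉ F)).inter
    (measurableSet_reachable hG v w)

theorem measurable_clusterCount (hG : ∀ u v, MeasurableSet {ω | (G ω).Adj u v}) {T : Set V}
    (hT : T.Finite) : Measurable fun ω => clusterCount (G ω) T := by
  classical
  induction T, hT using Set.Finite.induction_on with
  | empty => simp [clusterCount]
  | @insert v T _ hT ih =>
    simp only [clusterCount_insert hT]
    refine ih.add (Measurable.ite ?_ measurable_const measurable_const)
    simp only [Set.ofPred_and, Set.ofPred_forall]
    exact (measurableSet_supp_infinite hG v).inter (.iInter fun w => .iInter fun _ =>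
      (measurableSet_reachable hG w v).compl)

end Measurability

/-! ### Density limits -/

section Density

variable {Ω : Type} [MeasurableSpace Ω] {μ : Measure Ω} [IsProbabilityMeasure μ]

open Filter Topology ENNReal

/-- Bounded sequences of counts have zero density. -/
theorem eq_zero_of_mul_le_lintegral {f : ℕ → Ω → ℕ} (hf : ∀ n, Measurable (f n))
    (hle : ∀ n ω, f n ω ≤ n) (hbdd : ∀ᵐ ω ∂μ, ∃ B, ∀ n, f n ω ≤ B) {c : ℝ≥0∞}
    (hc : ∀ n : ℕ, n * c ≤ ∫⁻ ω, f n ω ∂μ) : c = 0 := by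
  -- Dominated convergence with bound `1`; the index `n + 1` avoids division by zero.
  have hlim : Tendsto (fun n : ℕ => ∫⁻ ω, (f (n + 1) ω : ℝ≥0∞) / (n + 1 : ℕ) ∂μ) atTop
      (𝓝 (∫⁻ _, 0 ∂μ)) := by
    refine tendsto_lintegral_of_dominated_convergence (fun _ => 1) ?_ ?_ (by simp) ?_
    · exact fun n => (measurable_from_top.comp (hf (n + 1))).div_const _
    · refine fun n => .of_forall fun ω => ENNReal.div_le_of_le_mul ?_
      rw [one_mul]
      exact_mod_cast hle (n + 1) ω
    · filter_upwards [hbdd] with ω ⟨B, hB⟩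
      have h0 : Tendsto (fun n : ℕ => (B : ℝ≥0∞) / (n + 1 : ℕ)) atTop (𝓝 0) :=
        (ENNReal.Tendsto.const_div ((tendsto_add_atTop_iff_nat 1).2 tendsto_nat_nhds_top)
          (.inr (natCast_ne_top B))).trans_eq (by simp)
      refine tendsto_of_tendsto_of_tendsto_of_le_of_le tendsto_const_nhds h0
        (fun _ => zero_le) fun n => ?_
      exact ENNReal.div_le_div_right (by exact_mod_cast hB (n + 1)) _
  rw [lintegral_zero] at hlim
  refine le_antisymm (ge_of_tendsto' hlim fun n => ?_) zero_le
  have hm : Measurable fun ω => (f (n + 1) ω : ℝ≥0∞) := measurable_from_top.comp (hf (n + 1))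
  simp only [div_eq_mul_inv]
  rw [lintegral_mul_const _ hm, ← div_eq_mul_inv,
    ENNReal.le_div_iff_mul_le (.inl (by simp)) (.inl (natCast_ne_top _)), mul_comm]
  exact hc (n + 1)

theorem le_of_forall_nat_mul_le {a b C : ℝ≥0∞} (hC : C ≠ ∞)
    (h : ∀ k : ℕ, k * a ≤ k * b + C) : a ≤ b := by
  have h0 : Tendsto (fun n : ℕ => b + C / (n + 1 : ℕ)) atTop (𝓝 (b + 0)) := by
    refine tendsto_const_nhds.add ((ENNReal.Tendsto.const_div
      ((tendsto_add_atTop_iff_nat 1).2 tendsto_nat_nhds_top) (.inr hC)).trans_eq (by simp))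
  rw [add_zero] at h0
  refine ge_of_tendsto' h0 fun n => ?_
  have hn : ((n + 1 : ℕ) : ℝ≥0∞) ≠ 0 := by simp
  have hn' : ((n + 1 : ℕ) : ℝ≥0∞) ≠ ∞ := natCast_ne_top _
  rw [← ENNReal.mul_le_mul_iff_right hn hn', mul_add, ENNReal.mul_div_cancel hn hn']
  exact h (n + 1)

end Density

/-! ### Half-plane subgraphs and their translates -/

section OpenIn

/-- The open subgraph of `ω` with only the edges inside `S` kept, on all vertices of the lattice. -/
def openIn (ω : Config squareLattice) (S : Set (ℤ × ℤ)) : SimpleGraph (ℤ × ℤ) where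
  Adj u v := (openGraph ω).Adj u v ∧ u ∈ S ∧ v ∈ S
  symm := ⟨fun _ _ h => ⟨h.1.symm, h.2.2, h.2.1⟩⟩
  loopless := ⟨fun _ h => h.1.ne rfl⟩

/-- The half-plane of vertices with second coordinate at least `m`. -/
def above (m : ℤ) : Set (ℤ × ℤ) := {v | m ≤ v.2}

theorem mem_above {m : ℤ} {v : ℤ × ℤ} : v ∈ above m ↔ m ≤ v.2 := Iff.rfl

variable {ω : Config squareLattice} {S : Set (ℤ × ℤ)}

theorem adj_of_openIn_adj {u v : ℤ × ℤ} (h : (openIn ω S).Adj u v) : squareLattice.Adj u v :=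
  h.1.1

theorem squareLattice_adj_iff {u v : ℤ × ℤ} : squareLattice.Adj u v ↔
    (v.1 = u.1 + 1 ∧ v.2 = u.2) ∨ (v.1 = u.1 ∧ v.2 = u.2 + 1) ∨
    (u.1 = v.1 + 1 ∧ u.2 = v.2) ∨ (u.1 = v.1 ∧ u.2 = v.2 + 1) := by
  simp only [squareLattice, Prod.ext_iff, Prod.fst_sub, Prod.snd_sub]
  omega

theorem mem_of_openIn_reachable {u v : ℤ × ℤ} (h : (openIn ω S).Reachable u v) (hne : u ≠ v) :
    u ∈ S := by
  obtain ⟨p⟩ := h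
  cases p with
  | nil => exact absurd rfl hne
  | cons h _ => exact h.2.1

theorem mem_of_supp_infinite {u : ℤ × ℤ}
    (h : ((openIn ω S).connectedComponentMk u).supp.Infinite) : u ∈ S := by
  obtain ⟨w, hw, huw⟩ := supp_infinite_iff.1 h {u}
  exact mem_of_openIn_reachable huw fun h => hw (by simp [h])

theorem openGraph_translate_adj (a : ℤ × ℤ) (u v : ℤ × ℤ) :
    (openGraph (translate a ω)).Adj (u + a) (v + a) ↔ (openGraph ω).Adj u v := by
  have h1 : squareLattice.Adj (u + a) (v + a) ↔ squareLattice.Adj u v :=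
    (translateIso a).map_rel_iff
  have h2 : ∀ h h', translate a ω ⟨s(u + a, v + a), h⟩ = ω ⟨s(u, v), h'⟩ := by
    intro h h'
    unfold translate
    congr 1
    apply Subtype.ext
    have hs : ∀ z, (translateIso a).symm (z + a) = z := fun z =>
      (translateIso a).symm_apply_apply z
    change s((translateIso a).symm (u + a), (translateIso a).symm (v + a)) = s(u, v)
    rw [hs, hs]
  constructor
  · rintro ⟨h, ho⟩
    exact ⟨h1.1 h, (h2 h (h1.1 h)).symm.trans ho⟩
  · rintro ⟨h, ho⟩
    exact ⟨h1.2 h, (h2 (h1.2 h) h).trans ho⟩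

/-- Translation by `a` identifies the open subgraph of `ω` inside `S` with that of the
translated configuration inside the translate of `S`. -/
def openInTranslateIso (ω : Config squareLattice) (S : Set (ℤ × ℤ)) (a : ℤ × ℤ) :
    openIn ω ((· + a) ⁻¹' S) ≃g openIn (translate a ω) S where
  toEquiv := Equiv.addRight a
  map_rel_iff' := by
    intro u v
    exact and_congr_left fun _ => openGraph_translate_adj a u v

theorem preimage_above (m : ℤ) (a : ℤ × ℤ) : (· + a) ⁻¹' above m = above (m - a.2) := by
  ext v
  simp [above]

theorem reachable_translate_above (a u v : ℤ × ℤ) (m : ℤ) :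
    (openIn (translate a ω) (above m)).Reachable (u + a) (v + a) ↔
      (openIn ω (above (m - a.2))).Reachable u v := by
  rw [← preimage_above]
  exact SimpleGraph.Iso.reachable_iff (φ := openInTranslateIso ω (above m) a)

theorem supp_infinite_translate_above (a u : ℤ × ℤ) (m : ℤ) :
    ((openIn (translate a ω) (above m)).connectedComponentMk (u + a)).supp.Infinite ↔
      ((openIn ω (above (m - a.2))).connectedComponentMk u).supp.Infinite := by
  rw [← preimage_above]
  exact supp_infinite_iso_iff (openInTranslateIso ω (above m) a)

theorem clusterCount_translate_above (a : ℤ × ℤ) (m : ℤ) (T : Set (ℤ × ℤ)) :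
    clusterCount (openIn (translate a ω) (above m)) ((· + a) '' T) =
      clusterCount (openIn ω (above (m - a.2))) T := by
  rw [← preimage_above]
  exact clusterCount_image_iso (openInTranslateIso ω (above m) a) T

theorem measurableSet_openGraph_adj {V : Type} {G : SimpleGraph V} (u v : V) :
    MeasurableSet {ω : Config G | (openGraph ω).Adj u v} := by
  by_cases h : G.Adj u v
  · have : {ω : Config G | (openGraph ω).Adj u v} = (fun ω => ω ⟨s(u, v), h⟩) ⁻¹' {true} := by
      ext ω
      exact ⟨fun h' => h'.2, fun h' => ⟨h, h'⟩⟩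
    rw [this]
    exact measurable_pi_apply _ (measurableSet_singleton _)
  · have : {ω : Config G | (openGraph ω).Adj u v} = ∅ := by
      ext ω
      exact ⟨fun h' => h h'.1, fun h' => h'.elim⟩
    rw [this]
    exact .empty

theorem measurableSet_openIn_adj (S : Set (ℤ × ℤ)) (u v : ℤ × ℤ) :
    MeasurableSet {ω | (openIn ω S).Adj u v} :=
  (measurableSet_openGraph_adj u v).inter (.const (u ∈ S ∧ v ∈ S))

end OpenIn

/-! ### Planarity through crossing parity -/

section Crossing

variable {ω : Config squareLattice}

/-- The crossing parity of a path with vertical rays going down, as a function of the starting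
point of the ray. -/
theorem exists_crossing_parity {u w : ℤ × ℤ} (p : (openIn ω (above 0)).Walk u w) :
    ∃ c : ℤ × ℤ → ZMod 2, (∀ x, c (x, 0) = 0) ∧
      (∀ x y, (x, y) ∉ p.support → (x, y + 1) ∉ p.support → c (x, y) = c (x, y + 1)) ∧
      (∀ x y, (x, y) ∉ p.support → (x + 1, y) ∉ p.support → c (x, y) + c (x + 1, y) =
        (if u.1 = x + 1 ∧ u.2 < y then 1 else 0) + (if w.1 = x + 1 ∧ w.2 < y then 1 else 0)) := by
  induction p with
  | nil =>
    exact ⟨fun _ => 0, fun _ => rfl, fun _ _ _ _ => rfl, fun x y _ _ => by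
      rw [CharTwo.add_self_eq_zero, CharTwo.add_self_eq_zero]⟩
  | @cons u v w h p ih =>
    obtain ⟨c, h0, hV, hH⟩ := ih
    obtain ⟨a, b⟩ := u
    obtain ⟨a', b'⟩ := v
    have hu : 0 ≤ b := h.2.1
    have hadj := squareLattice_adj_iff.1 (adj_of_openIn_adj h)
    have hv : (a', b') ∈ p.support := p.start_mem_support
    -- The ray descends from `(x + 1/2, y)`, so it crosses exactly the horizontal edges from column
    -- `x` to `x + 1` at heights below `y`.
    refine ⟨fun z => c z + if b = b' ∧ min a a' = z.1 ∧ b < z.2 then 1 else 0, ?_, ?_, ?_⟩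
    · intro x
      simp only [h0, zero_add]
      rw [if_neg]
      omega
    · intro x y h1 h2
      simp only [SimpleGraph.Walk.support_cons, List.mem_cons, not_or] at h1 h2
      have n1 : (x, y) ≠ (a', b') := fun hh => h1.2 (by rw [hh]; exact hv)
      have n1' := h1.1
      simp only [ne_eq, Prod.mk.injEq] at hadj n1 n1'
      simp only [hV x y h1.2 h2.2]
      congr 2
      apply propext
      omega
    · intro x y h1 h2
      simp only [SimpleGraph.Walk.support_cons, List.mem_cons, not_or] at h1 h2
      have n1 : (x, y) ≠ (a', b') := fun hh => h1.2 (by rw [hh]; exact hv)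
      have n2 : (x + 1, y) ≠ (a', b') := fun hh => h2.2 (by rw [hh]; exact hv)
      have n1' := h1.1
      have n2' := h2.1
      have key := hH x y h1.2 h2.2
      simp only [ne_eq, Prod.mk.injEq] at hadj n1 n1' n2 n2' key ⊢
      -- Handshake count, mod 2, on the part of column `x + 1` below `y`: a horizontal edge has one
      -- endpoint in that column, while a vertical edge there has both or neither below `y`, since
      -- `(x + 1, y)` is off the path.
      have hloc : (if b = b' ∧ min a a' = x ∧ b < y then (1 : ZMod 2) else 0) +
          (if b = b' ∧ min a a' = x + 1 ∧ b < y then 1 else 0) =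
          (if a = x + 1 ∧ b < y then 1 else 0) + (if a' = x + 1 ∧ b' < y then 1 else 0) := by
        split_ifs <;> first | omega | rfl
      have h2 : (if a' = x + 1 ∧ b' < y then (1 : ZMod 2) else 0) +
        (if a' = x + 1 ∧ b' < y then 1 else 0) = 0 := CharTwo.add_self_eq_zero _
      linear_combination key + hloc + h2

theorem reachable_of_interlaced {x₁ x₂ x₃ x₄ : ℤ} (h₁₂ : x₁ < x₂) (h₂₃ : x₂ < x₃) (h₃₄ : x₃ < x₄)
    (h₁₃ : (openIn ω (above 0)).Reachable (x₁, 0) (x₃, 0))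
    (h₂₄ : (openIn ω (above 0)).Reachable (x₂, 0) (x₄, 0)) :
    (openIn ω (above 0)).Reachable (x₁, 0) (x₂, 0) := by
  by_contra hcon
  obtain ⟨p⟩ := h₁₃
  obtain ⟨q⟩ := h₂₄
  obtain ⟨c, h0, hV, hH⟩ := exists_crossing_parity p
  have hp : ∀ z, (openIn ω (above 0)).Reachable (x₂, 0) z → z ∉ p.support := fun z hz hzp =>
    hcon ((p.takeUntil z hzp).reachable.trans hz.symm)
  -- The two indicators close `p` up by a segment from `x₁` to `x₃` just below row `0`; `g` is the
  -- crossing parity of the closed curve, hence constant on clusters avoiding `p`.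
  let g : ℤ × ℤ → ZMod 2 := fun z =>
    c z + (if x₁ ≤ z.1 then 1 else 0) + (if x₃ ≤ z.1 then 1 else 0)
  have gV : ∀ x y, (x, y) ∉ p.support → (x, y + 1) ∉ p.support → g (x, y) = g (x, y + 1) := by
    intro x y h1 h2
    simp only [g, hV x y h1 h2]
  have gH : ∀ x y, 0 ≤ y → (x, y) ∉ p.support → (x + 1, y) ∉ p.support →
      g (x, y) = g (x + 1, y) := by
    intro x y hy h1 h2
    have key := hH x y h1 h2
    have e1 : (x + 1, y) ≠ (x₁, 0) := fun hh => h2 (by rw [hh]; exact p.start_mem_support)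
    have e3 : (x + 1, y) ≠ (x₃, 0) := fun hh => h2 (by rw [hh]; exact p.end_mem_support)
    simp only [ne_eq, Prod.mk.injEq] at e1 e3 key
    have hloc : ∀ z : ℤ, ¬ (x + 1 = z ∧ y = 0) → (if z ≤ x then (1 : ZMod 2) else 0) +
        (if z ≤ x + 1 then 1 else 0) = if z = x + 1 ∧ 0 < y then 1 else 0 := by
      intro z hz
      split_ifs <;> first | omega | rfl
    rw [← CharTwo.add_eq_zero]
    simp only [g]
    have d1 := hloc x₁ e1
    have d3 := hloc x₃ e3
    have t : ∀ s : ZMod 2, s + s = 0 := CharTwo.add_self_eq_zero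
    linear_combination key + d1 + d3 + t (if x₁ = x + 1 ∧ 0 < y then 1 else 0) +
      t (if x₃ = x + 1 ∧ 0 < y then 1 else 0)
  have gadj : ∀ z z', (openIn ω (above 0)).Reachable (x₂, 0) z → (openIn ω (above 0)).Adj z z' →
      g z = g z' := by
    rintro ⟨x, y⟩ ⟨x', y'⟩ hz hzz'
    have n1 := hp _ hz
    have n2 := hp _ (hz.trans hzz'.reachable)
    have hy : 0 ≤ y := hzz'.2.1
    rcases squareLattice_adj_iff.1 (adj_of_openIn_adj hzz') with h | h | h | h <;>
      obtain ⟨e1, e2⟩ := h <;> simp only at e1 e2 <;> subst e1 <;> subst e2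
    · exact gH x _ hy n1 n2
    · exact gV _ y n1 n2
    · exact (gH x' _ hy n2 n1).symm
    · exact (gV _ y' n2 n1).symm
  have gconst : ∀ z z' (r : (openIn ω (above 0)).Walk z z'),
      (openIn ω (above 0)).Reachable (x₂, 0) z → g z = g z' := by
    intro z z' r
    induction r with
    | nil => exact fun _ => rfl
    | cons h _ ih => exact fun hz => (gadj _ _ hz h).trans (ih (hz.trans h.reachable))
  have := gconst _ _ q (.refl _)
  -- `(x₂, 0)` is inside the closed curve, with `g = 1`, and `(x₄, 0)` is outside, with `g = 1 + 1 =
  -- 0`.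
  simp only [g, h0] at this
  rw [if_pos (by omega), if_neg (by omega), if_pos (by omega), if_pos (by omega)] at this
  revert this
  decide

end Crossing

/-! ### Zero boundary density of half-plane clusters -/

open Filter Topology ENNReal

/-- The vertices of row `j` with first coordinate in `[a, b)`. -/
def segment (a b j : ℤ) : Set (ℤ × ℤ) := Set.Ico a b ×ˢ {j}

theorem mem_segment {a b j : ℤ} {v : ℤ × ℤ} : v ∈ segment a b j ↔ (a ≤ v.1 ∧ v.1 < b) ∧ v.2 = j :=
  Iff.rfl

theorem segment_finite (a b j : ℤ) : (segment a b j).Finite :=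
  (Set.finite_Ico a b).prod (Set.finite_singleton j)

theorem ncard_segment (n : ℕ) (j : ℤ) : (segment 0 n j).ncard = n := by
  rw [segment, Set.ncard_prod, Set.ncard_singleton, mul_one, ← Nat.card_coe_set_eq]
  simp

theorem image_add_segment (a b j : ℤ) (c : ℤ × ℤ) :
    (· + c) '' segment a b j = segment (a + c.1) (b + c.1) (j + c.2) := by
  ext v
  constructor
  · rintro ⟨w, hw, rfl⟩
    simp only [mem_segment, Prod.fst_add, Prod.snd_add] at hw ⊢
    omega
  · intro hv
    refine ⟨v - c, ?_, sub_add_cancel _ _⟩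
    simp only [mem_segment, Prod.fst_sub, Prod.snd_sub] at hv ⊢
    omega

/-- An infinite cluster of the half-plane above `-m` that meets the bottom of a box of height `m`
leaves the box through its top or one of its two vertical sides. -/
theorem clusterCount_bottom_le (ω : Config squareLattice) (m n : ℕ) :
    clusterCount (openIn ω (above (-m))) (segment 0 n (-m)) ≤
      clusterCount (openIn ω (above (-m))) (segment 0 n 0) + 2 * (m + 1) := by
  set sides : Set (ℤ × ℤ) := {0, (n : ℤ) - 1} ×ˢ Set.Icc (-(m : ℤ)) 0 with hsides
  have hfin : sides.Finite := (Set.toFinite _).prod (Set.finite_Icc _ _)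
  have hcard : sides.ncard ≤ 2 * (m + 1) := by
    rw [hsides, Set.ncard_prod]
    refine Nat.mul_le_mul ((Set.ncard_insert_le _ _).trans_eq (by simp)) ?_
    rw [← Nat.card_coe_set_eq]
    simp
    omega
  have hexit : clusterCount (openIn ω (above (-m))) (segment 0 n (-m)) ≤
      clusterCount (openIn ω (above (-m))) (segment 0 n 0 ∪ sides) := by
    refine clusterCount_le_of_forall ((segment_finite _ _ _).union hfin) fun v hv hinf => ?_
    set B : Set (ℤ × ℤ) := Set.Ico 0 (n : ℤ) ×ˢ Set.Icc (-(m : ℤ)) 0 with hB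
    have hBfin : B.Finite := (Set.finite_Ico _ _).prod (Set.finite_Icc _ _)
    obtain ⟨w, hw, hvw⟩ := supp_infinite_iff.1 hinf hBfin.toFinset
    rw [hBfin.mem_toFinset] at hw
    have hvB : v ∈ B := by
      simp only [mem_segment] at hv
      simp only [hB, Set.mem_prod, Set.mem_Ico, Set.mem_Icc]
      omega
    obtain ⟨p⟩ := hvw
    -- The path cannot leave the box downwards, as row `-m` bounds the half-plane; so `d.fst` is on
    -- the top or a side.
    obtain ⟨d, hd, hd1, hd2⟩ := p.exists_boundary_dart B hvB hw
    refine ⟨d.fst, ?_, (p.takeUntil _ (p.dart_fst_mem_support_of_mem_darts hd)).reachable⟩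
    have hadj := squareLattice_adj_iff.1 (adj_of_openIn_adj d.adj)
    have habove : -(m : ℤ) ≤ d.snd.2 := d.adj.2.2
    simp only [hB, Set.mem_prod, Set.mem_Ico, Set.mem_Icc] at hd1 hd2
    simp only [hsides, Set.mem_union, mem_segment, Set.mem_prod, Set.mem_insert_iff,
      Set.mem_singleton_iff, Set.mem_Icc]
    omega
  have h1 := clusterCount_union_le (G := openIn ω (above (-m))) (segment 0 n 0) sides
  have h2 := clusterCount_le_ncard (G := openIn ω (above (-m))) hfin
  omega

theorem eventually_reachable_above {ω : Config squareLattice} {u v : ℤ × ℤ}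
    (h : (openGraph ω).Reachable u v) :
    ∀ᶠ m : ℕ in atTop, (openIn ω (above (-m))).Reachable u v := by
  obtain ⟨p⟩ := h
  induction p with
  | nil => exact .of_forall fun _ => .refl _
  | @cons u w v h p ih =>
    have h1 := eventually_ge_atTop (-u.2).toNat
    have h2 := eventually_ge_atTop (-w.2).toNat
    filter_upwards [ih, h1, h2] with m hm h1 h2
    have hadj : (openIn ω (above (-m))).Adj u w := by
      refine ⟨h, ?_, ?_⟩ <;> rw [mem_above] <;> omega
    exact hadj.reachable.trans hm

/-- Each of the finitely many plane connections between points of `T` uses a finite path, which lies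
above `-m` for large `m`. -/
theorem eventually_clusterCount_above_le (ω : Config squareLattice) {T : Set (ℤ × ℤ)}
    (hT : T.Finite) : ∀ᶠ m : ℕ in atTop,
      clusterCount (openIn ω (above (-m))) T ≤ clusterCount (openGraph ω) T := by
  have : ∀ᶠ m : ℕ in atTop, ∀ u ∈ T, ∀ v ∈ T, (openGraph ω).Reachable u v →
      (openIn ω (above (-m))).Reachable u v := by
    refine (eventually_all_finite hT).2 fun u _ => (eventually_all_finite hT).2 fun v _ => ?_
    by_cases h : (openGraph ω).Reachable u v
    · filter_upwards [eventually_reachable_above h] with m hm _ using hm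
    · exact .of_forall fun _ h' => absurd h' h
  filter_upwards [this] with m hm
  refine clusterCount_le_of_le ?_ hT hm
  exact fun _ _ h => h.1

variable {μ : Measure (Config squareLattice)}

/-- The mean number of infinite clusters of the half-plane above `m` that meet `T`. -/
noncomputable def meanCount (μ : Measure (Config squareLattice)) (m : ℤ) (T : Set (ℤ × ℤ)) :
    ℝ≥0∞ :=
  ∫⁻ ω, clusterCount (openIn ω (above m)) T ∂μ

theorem measurable_clusterCount_above (m : ℤ) {T : Set (ℤ × ℤ)} (hT : T.Finite) :
    Measurable fun ω => (clusterCount (openIn ω (above m)) T : ℝ≥0∞) :=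
  measurable_from_top.comp (measurable_clusterCount (measurableSet_openIn_adj _) hT)

theorem meanCount_image_add (hμ : TranslationInvariant μ) (m : ℤ) (a : ℤ × ℤ)
    {T : Set (ℤ × ℤ)} (hT : T.Finite) :
    meanCount μ m ((· + a) '' T) = meanCount μ (m - a.2) T := by
  unfold meanCount
  conv_lhs => rw [← hμ a]
  rw [lintegral_map (measurable_clusterCount_above m (hT.image _)) (measurable_translate a)]
  simp only [clusterCount_translate_above]

theorem measure_preimage_translate (hμ : TranslationInvariant μ) (a : ℤ × ℤ)
    {E : Set (Config squareLattice)} (hE : MeasurableSet E) : μ (translate a ⁻¹' E) = μ E := by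
  rw [← Measure.map_apply (measurable_translate a) hE, hμ a]

theorem meanCount_segment_mul_le (hμ : TranslationInvariant μ) (m j : ℤ) (n k : ℕ) :
    meanCount μ m (segment 0 ((k * n : ℕ) : ℤ) j) ≤ k * meanCount μ m (segment 0 n j) := by
  induction k with
  | zero => simp [meanCount, segment, clusterCount]
  | succ k ih =>
    have hunion : segment 0 (((k + 1) * n : ℕ) : ℤ) j ⊆ segment 0 ((k * n : ℕ) : ℤ) j ∪
        (· + (((k * n : ℕ) : ℤ), 0)) '' segment 0 n j := by
      intro v hv
      rw [image_add_segment]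
      simp only [Set.mem_union, mem_segment, Nat.add_mul] at hv ⊢
      push_cast at hv ⊢
      omega
    have hfin := (segment_finite 0 ((k * n : ℕ) : ℤ) j).union
      ((segment_finite 0 n j).image (· + (((k * n : ℕ) : ℤ), 0)))
    calc meanCount μ m (segment 0 (((k + 1) * n : ℕ) : ℤ) j)
        ≤ meanCount μ m (segment 0 ((k * n : ℕ) : ℤ) j) +
          meanCount μ m ((· + (((k * n : ℕ) : ℤ), 0)) '' segment 0 n j) := by
          unfold meanCount
          rw [← lintegral_add_left (measurable_clusterCount_above m (segment_finite _ _ _))]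
          refine lintegral_mono fun ω => ?_
          dsimp only
          exact_mod_cast (clusterCount_mono hfin hunion).trans (clusterCount_union_le _ _)
      _ ≤ k * meanCount μ m (segment 0 n j) + meanCount μ m (segment 0 n j) := by
          rw [meanCount_image_add hμ _ _ (segment_finite _ _ _)]
          simp only [sub_zero]
          gcongr
      _ = ((k + 1 : ℕ) : ℝ≥0∞) * meanCount μ m (segment 0 n j) := by
          push_cast
          ring

theorem lintegral_sum_indicator_translate (hμ : TranslationInvariant μ)
    {E : Set (Config squareLattice)} (hE : MeasurableSet E) (a : ℕ → ℤ × ℤ) (n : ℕ) :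
    ∫⁻ ω, ∑ i ∈ Finset.range n, (translate (a i) ⁻¹' E).indicator 1 ω ∂μ = n * μ E := by
  have hm : ∀ i, MeasurableSet (translate (a i) ⁻¹' E) := fun i => measurable_translate _ hE
  rw [lintegral_finsetSum _ fun i _ => measurable_one.indicator (hm i)]
  simp only [lintegral_indicator_one (hm _), measure_preimage_translate hμ _ hE, Finset.sum_const,
    Finset.card_range, nsmul_eq_mul]

variable [IsProbabilityMeasure μ]

/-- A bottom segment of length `k * n` is compared with `k` translates of the top segment; the cost
`2 * (m + 1)` of the sides does not depend on `k` and disappears on dividing by `k`. -/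
theorem mul_le_meanCount_lower (hμ : TranslationInvariant μ) {c : ℝ≥0∞}
    (hc : ∀ n : ℕ, n * c ≤ meanCount μ 0 (segment 0 n 0)) (m n : ℕ) :
    n * c ≤ meanCount μ (-m) (segment 0 n 0) := by
  refine le_of_forall_nat_mul_le (C := (2 * (m + 1) : ℕ)) (natCast_ne_top _) fun k => ?_
  calc (k : ℝ≥0∞) * (n * c) = (k * n : ℕ) * c := by push_cast; ring
    _ ≤ meanCount μ 0 (segment 0 (k * n : ℕ) 0) := hc _
    _ = meanCount μ (-m) (segment 0 (k * n : ℕ) (-m)) := by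
        have := meanCount_image_add hμ (-m) (0, -m) (segment_finite 0 (k * n : ℕ) 0)
        rw [image_add_segment] at this
        simpa using this.symm
    _ ≤ meanCount μ (-m) (segment 0 (k * n : ℕ) 0) + (2 * (m + 1) : ℕ) := by
        have hconst : ((2 * (m + 1) : ℕ) : ℝ≥0∞) = ∫⁻ _, (2 * (m + 1) : ℕ) ∂μ := by simp
        unfold meanCount
        rw [hconst, ← lintegral_add_left (measurable_clusterCount_above _ (segment_finite _ _ _))]
        refine lintegral_mono fun ω => ?_
        dsimp only
        exact_mod_cast clusterCount_bottom_le ω m (k * n)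
    _ ≤ k * meanCount μ (-m) (segment 0 n 0) + (2 * (m + 1) : ℕ) := by
        gcongr
        exact meanCount_segment_mul_le hμ _ _ _ _

/-- Reverse Fatou as `m → ∞`, with all counts bounded by `n`. -/
theorem mul_le_lintegral_clusterCount (hμ : TranslationInvariant μ) {c : ℝ≥0∞}
    (hc : ∀ n : ℕ, n * c ≤ meanCount μ 0 (segment 0 n 0)) (n : ℕ) :
    n * c ≤ ∫⁻ ω, clusterCount (openGraph ω) (segment 0 n 0) ∂μ := by
  have hfin := segment_finite 0 n 0
  have hbound : ∀ m : ℕ, ∀ᵐ ω ∂μ,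
      (clusterCount (openIn ω (above (-m))) (segment 0 n 0) : ℝ≥0∞) ≤ n := by
    refine fun m => .of_forall fun ω => ?_
    exact_mod_cast (clusterCount_le_ncard hfin).trans_eq (ncard_segment n 0)
  calc (n : ℝ≥0∞) * c
      ≤ limsup (fun m : ℕ => meanCount μ (-m) (segment 0 n 0)) atTop :=
        le_limsup_of_frequently_le
          (Frequently.of_forall fun m => mul_le_meanCount_lower hμ hc m n)
    _ ≤ ∫⁻ ω, limsup (fun m : ℕ =>
          (clusterCount (openIn ω (above (-m))) (segment 0 n 0) : ℝ≥0∞)) atTop ∂μ :=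
        limsup_lintegral_le (g := fun _ => n)
          (fun m => measurable_clusterCount_above _ hfin) hbound (by simp)
    _ ≤ ∫⁻ ω, clusterCount (openGraph ω) (segment 0 n 0) ∂μ := by
        refine lintegral_mono fun ω => limsup_le_of_le (h := ?_)
        filter_upwards [eventually_clusterCount_above_le ω hfin] with m hm
        exact_mod_cast hm

/-- If the whole plane has finitely many infinite clusters, then the infinite clusters of the
half-plane have zero density along its boundary. -/
theorem eq_zero_of_mul_le_meanCount (hμ : TranslationInvariant μ)
    (hfin : ∀ᵐ ω ∂μ, (infiniteClusters ω).Finite) {c : ℝ≥0∞}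
    (hc : ∀ n : ℕ, n * c ≤ meanCount μ 0 (segment 0 n 0)) : c = 0 := by
  refine eq_zero_of_mul_le_lintegral (μ := μ)
    (f := fun n ω => clusterCount (openGraph ω) (segment 0 n 0)) ?_ ?_ ?_
    (mul_le_lintegral_clusterCount hμ hc)
  · exact fun n => measurable_clusterCount measurableSet_openGraph_adj (segment_finite _ _ _)
  · exact fun n ω => (clusterCount_le_ncard (segment_finite _ _ _)).trans_eq (ncard_segment n 0)
  · filter_upwards [hfin] with ω hω
    exact ⟨_, fun n => Set.ncard_le_ncard Set.inter_subset_right hω⟩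

/-! ### Extremal boundary vertices and lowest rows -/

/-- The vertex `(x, 0)` lies in an infinite cluster of the upper half-plane that contains no
`(y, 0)` with `Q (y - x)`. -/
def extremalEvent (Q : ℤ → Prop) (x : ℤ) : Set (Config squareLattice) :=
  {ω | ((openIn ω (above 0)).connectedComponentMk (x, 0)).supp.Infinite ∧
    ∀ y, Q (y - x) → ¬ (openIn ω (above 0)).Reachable (x, 0) (y, 0)}

theorem measurableSet_extremalEvent (Q : ℤ → Prop) (x : ℤ) :
    MeasurableSet (extremalEvent Q x) := by
  simp only [extremalEvent, Set.ofPred_and, Set.ofPred_forall]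
  exact (measurableSet_supp_infinite (measurableSet_openIn_adj _) _).inter
    (.iInter fun y => .iInter fun _ =>
      (measurableSet_reachable (measurableSet_openIn_adj _) _ _).compl)

theorem preimage_translate_extremalEvent (Q : ℤ → Prop) (x : ℤ) :
    translate (-x, 0) ⁻¹' extremalEvent Q 0 = extremalEvent Q x := by
  ext ω
  have hinf := supp_infinite_translate_above (ω := ω) (-x, 0) (x, 0) 0
  have hreach := fun y => reachable_translate_above (ω := ω) (-x, 0) (x, 0) (y + x, 0) 0
  simp only [Prod.mk_add_mk, add_neg_cancel, add_neg_cancel_right, add_zero, sub_zero]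
    at hinf hreach
  simp only [extremalEvent, Set.mem_preimage, Set.mem_ofPred_eq, hinf, hreach, sub_zero]
  refine and_congr_right fun _ => ⟨fun h y hy => ?_, fun h y hy => ?_⟩
  · simpa using h (y - x) hy
  · exact h (y + x) (by simpa using hy)

theorem sum_indicator_eq_card {Ω ι : Type} (E : ι → Set Ω) (s : Finset ι) (ω : Ω)
    [DecidablePred fun i => ω ∈ E i] :
    ∑ i ∈ s, (E i).indicator (1 : Ω → ℝ≥0∞) ω = (s.filter fun i => ω ∈ E i).card := by
  classical
  simp [Set.indicator_apply, Finset.sum_boole]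

/-- The open subgraph of a translated configuration is isomorphic to the original one. -/
def openGraphTranslateIso (ω : Config squareLattice) (a : ℤ × ℤ) :
    openGraph ω ≃g openGraph (translate a ω) where
  toEquiv := Equiv.addRight a
  map_rel_iff' := openGraph_translate_adj a _ _

/-- Some infinite cluster of the plane has lowest row `j`. -/
def lowestRowEvent (j : ℤ) : Set (Config squareLattice) :=
  {ω | ∃ x, ((openGraph ω).connectedComponentMk (x, j)).supp.Infinite ∧
    ∀ w, (openGraph ω).Reachable (x, j) w → j ≤ w.2}

theorem measurableSet_lowestRowEvent (j : ℤ) : MeasurableSet (lowestRowEvent j) := by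
  simp only [lowestRowEvent, Set.ofPred_exists, Set.ofPred_and, Set.ofPred_forall]
  refine .iUnion fun x => (measurableSet_supp_infinite measurableSet_openGraph_adj _).inter
    (.iInter fun w => ?_)
  by_cases h : j ≤ w.2
  · simp [h]
  · simp only [h, imp_false]
    exact (measurableSet_reachable
      (measurableSet_openGraph_adj (G := squareLattice)) (x, j) w).compl

theorem preimage_translate_lowestRowEvent (j : ℤ) :
    translate (0, -j) ⁻¹' lowestRowEvent 0 = lowestRowEvent j := by
  ext ω
  have happ : ∀ z, openGraphTranslateIso ω (0, -j) z = z + (0, -j) := fun _ => rfl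
  have hz : ∀ x, ((x, 0) : ℤ × ℤ) = openGraphTranslateIso ω (0, -j) (x, j) := fun x => by
    simp [happ]
  simp only [lowestRowEvent, Set.mem_preimage, Set.mem_ofPred_eq]
  refine exists_congr fun x => ?_
  rw [hz, supp_infinite_iso_iff, (openGraphTranslateIso ω (0, -j)).surjective.forall]
  refine and_congr_right fun _ => forall_congr' fun w =>
    imp_congr (openGraphTranslateIso ω (0, -j)).reachable_iff ?_
  rw [happ, Prod.snd_add]
  omega

section Measure

variable {μ : Measure (Config squareLattice)} [IsProbabilityMeasure μ]

/-- By `hQ`, two distinct extremal vertices cannot share a cluster, so the extremal vertices in a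
segment number at most the clusters meeting it. Their mean number is `n` times the probability,
which the density bound forces to be zero. -/
theorem measure_extremalEvent (hμ : TranslationInvariant μ)
    (hfin : ∀ᵐ ω ∂μ, (infiniteClusters ω).Finite) {Q : ℤ → Prop}
    (hQ : ∀ d, d ≠ 0 → Q d ∨ Q (-d)) (x : ℤ) : μ (extremalEvent Q x) = 0 := by
  classical
  rw [← preimage_translate_extremalEvent,
    measure_preimage_translate hμ _ (measurableSet_extremalEvent Q 0)]
  refine eq_zero_of_mul_le_meanCount hμ hfin fun n => ?_
  rw [← lintegral_sum_indicator_translate hμ (measurableSet_extremalEvent Q 0)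
    fun i => (-(i : ℤ), 0)]
  refine lintegral_mono fun ω => ?_
  simp only [preimage_translate_extremalEvent]
  rw [sum_indicator_eq_card fun i : ℕ => extremalEvent Q i, Nat.cast_le]
  set s := (Finset.range n).filter fun i : ℕ => ω ∈ extremalEvent Q i
  have hinj : Function.Injective fun i : ℕ => ((i : ℤ), (0 : ℤ)) := fun i j h => by simpa using h
  rw [← Set.ncard_coe_finset, ← Set.ncard_image_of_injective _ hinj]
  refine ncard_le_clusterCount (segment_finite _ _ _) ?_ ?_ ?_
  · rintro _ ⟨i, hi, rfl⟩
    have := (Finset.mem_filter.1 hi).1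
    rw [Finset.mem_range] at this
    exact ⟨⟨Int.natCast_nonneg i, Int.ofNat_lt.2 this⟩, rfl⟩
  · rintro _ ⟨i, hi, rfl⟩
    exact (Finset.mem_filter.1 hi).2.1
  · rintro _ ⟨i, hi, rfl⟩ _ ⟨j, hj, rfl⟩ hij
    by_contra hne
    have hd : (j : ℤ) - i ≠ 0 := fun h => hne (congrArg (·, (0 : ℤ)) (sub_eq_zero.1 h).symm)
    rcases hQ _ hd with h | h
    · exact (Finset.mem_filter.1 hi).2.2 _ h hij
    · rw [neg_sub] at h
      exact (Finset.mem_filter.1 hj).2.2 _ h hij.symm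

/-- Clusters with different lowest rows are different, so almost surely only finitely many rows `j`
qualify, whereas invariance gives each row the same probability. -/
theorem measure_lowestRowEvent (hμ : TranslationInvariant μ)
    (hfin : ∀ᵐ ω ∂μ, (infiniteClusters ω).Finite) (j : ℤ) : μ (lowestRowEvent j) = 0 := by
  classical
  rw [← preimage_translate_lowestRowEvent,
    measure_preimage_translate hμ _ (measurableSet_lowestRowEvent 0)]
  refine eq_zero_of_mul_le_lintegral (μ := μ)
    (f := fun n ω => ((Finset.range n).filter fun i : ℕ => ω ∈ lowestRowEvent i).card)
    ?_ ?_ ?_ fun n => ?_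
  · intro n
    simp only [Finset.card_filter]
    exact Finset.measurable_fun_sum _ fun i _ =>
      Measurable.ite (measurableSet_lowestRowEvent i) measurable_const measurable_const
  · exact fun n ω => (Finset.card_filter_le _ _).trans_eq (Finset.card_range n)
  · filter_upwards [hfin] with ω hω
    refine ⟨(infiniteClusters ω).ncard, fun n => ?_⟩
    have hex : ∀ i : ℕ, ∃ x, ω ∈ lowestRowEvent i →
        ((openGraph ω).connectedComponentMk (x, (i : ℤ))).supp.Infinite ∧
        ∀ w, (openGraph ω).Reachable (x, (i : ℤ)) w → (i : ℤ) ≤ w.2 := fun i => by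
      by_cases h : ω ∈ lowestRowEvent i
      · exact ⟨h.choose, fun _ => h.choose_spec⟩
      · exact ⟨0, fun h' => absurd h' h⟩
    choose x hx using hex
    rw [← Set.ncard_coe_finset]
    refine Set.ncard_le_ncard_of_injOn
      (fun i : ℕ => (openGraph ω).connectedComponentMk (x i, (i : ℤ))) ?_ ?_ hω
    · exact fun i hi => (hx i (Finset.mem_filter.1 hi).2).1
    · intro i hi j hj hij
      have hreach := SimpleGraph.ConnectedComponent.exact hij
      have h1 := (hx i (Finset.mem_filter.1 hi).2).2 _ hreach
      have h2 := (hx j (Finset.mem_filter.1 hj).2).2 _ hreach.symm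
      simp only at h1 h2
      omega
  · rw [← lintegral_sum_indicator_translate hμ (measurableSet_lowestRowEvent 0)
      fun i => (0, -(i : ℤ))]
    refine lintegral_mono fun ω => ?_
    simp only [preimage_translate_lowestRowEvent]
    rw [sum_indicator_eq_card fun i : ℕ => lowestRowEvent i]

end Measure

/-! ### Uniqueness outside the null events -/

section Deterministic

variable {ω : Config squareLattice}

/-- An infinite cluster of the upper half-plane reaches the boundary row unless it is an infinite
cluster of the plane. -/
theorem exists_reachable_boundary (hlow : ∀ j, ω ∉ lowestRowEvent j) {v : ℤ × ℤ}
    (hv : ((openIn ω (above 0)).connectedComponentMk v).supp.Infinite) :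
    ∃ x, (openIn ω (above 0)).Reachable v (x, 0) := by
  by_contra! hcon
  have hpos : ∀ w, (openIn ω (above 0)).Reachable v w → 0 < w.2 := by
    intro w hw
    have h0 : 0 ≤ w.2 := mem_of_supp_infinite ((supp_infinite_congr hw).1 hv)
    refine lt_of_le_of_ne h0 fun h => hcon w.1 ?_
    rwa [show (w.1, (0 : ℤ)) = w from Prod.ext rfl h]
  -- A cluster that avoids row `0` is not cut by the boundary: any open plane edge at one of its
  -- vertices stays in the half-plane.
  have hclosed : ∀ u w (p : (openGraph ω).Walk u w), (openIn ω (above 0)).Reachable v u →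
      (openIn ω (above 0)).Reachable v w := by
    intro u w p
    induction p with
    | nil => exact id
    | @cons a b _ h _ ih =>
      intro ha
      have h1 := hpos a ha
      have hadj : (openIn ω (above 0)).Adj a b := by
        have := squareLattice_adj_iff.1 h.1
        refine ⟨h, ?_, ?_⟩ <;> rw [mem_above] <;> omega
      exact ih (ha.trans hadj.reachable)
  have hplane : ∀ w, (openGraph ω).Reachable v w → (openIn ω (above 0)).Reachable v w :=
    fun w ⟨p⟩ => hclosed v w p (.refl _)
  obtain ⟨j, ⟨w, hw, hwj⟩, hmin⟩ := Int.exists_least_of_bdd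
    (P := fun j => ∃ w, (openGraph ω).Reachable v w ∧ w.2 = j)
    ⟨0, fun _ ⟨w, hw, hwj⟩ => hwj ▸ (hpos w (hplane w hw)).le⟩ ⟨v.2, v, .refl _, rfl⟩
  refine hlow j ⟨w.1, ?_⟩
  rw [show (w.1, j) = w from Prod.ext rfl hwj.symm]
  refine ⟨(supp_infinite_congr hw).1 ?_, fun z hz => hmin _ ⟨z, hw.trans hz, rfl⟩⟩
  exact supp_infinite_of_reachable_imp (f := id) Function.injective_id
    (fun z hz => hz.mono fun _ _ h => And.left h) hv

/-- With no extremal vertices, each cluster meets row `0` arbitrarily far in both directions, so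
boundary vertices alternating between the two clusters can be chosen. -/
theorem reachable_of_supp_infinite (hlow : ∀ j, ω ∉ lowestRowEvent j)
    (hright : ∀ x, ω ∉ extremalEvent (0 < ·) x) (hleft : ∀ x, ω ∉ extremalEvent (· < 0) x)
    {u v : ℤ × ℤ} (hu : ((openIn ω (above 0)).connectedComponentMk u).supp.Infinite)
    (hv : ((openIn ω (above 0)).connectedComponentMk v).supp.Infinite) :
    (openIn ω (above 0)).Reachable u v := by
  have hR : ∀ z, ((openIn ω (above 0)).connectedComponentMk z).supp.Infinite →
      ∀ b : ℤ, ∃ x, b < x ∧ (openIn ω (above 0)).Reachable z (x, 0) := by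
    intro z hz b
    by_contra! hcon
    obtain ⟨x, hx, hmax⟩ := Int.exists_greatest_of_bdd
      (P := fun x => (openIn ω (above 0)).Reachable z (x, 0))
      ⟨b, fun x hx => not_lt.1 fun h => hcon x h hx⟩ (exists_reachable_boundary hlow hz)
    refine hright x ⟨(supp_infinite_congr hx).1 hz, fun y hy hxy => ?_⟩
    have := hmax y (hx.trans hxy)
    omega
  have hL : ∀ z, ((openIn ω (above 0)).connectedComponentMk z).supp.Infinite →
      ∀ b : ℤ, ∃ x, x < b ∧ (openIn ω (above 0)).Reachable z (x, 0) := by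
    intro z hz b
    by_contra! hcon
    obtain ⟨x, hx, hmin⟩ := Int.exists_least_of_bdd
      (P := fun x => (openIn ω (above 0)).Reachable z (x, 0))
      ⟨b, fun x hx => not_lt.1 fun h => hcon x h hx⟩ (exists_reachable_boundary hlow hz)
    refine hleft x ⟨(supp_infinite_congr hx).1 hz, fun y hy hxy => ?_⟩
    have := hmin y (hx.trans hxy)
    omega
  obtain ⟨x₂, h₂⟩ := exists_reachable_boundary hlow hv
  obtain ⟨x₁, h₁₂, h₁⟩ := hL u hu x₂
  obtain ⟨x₃, h₂₃, h₃⟩ := hR u hu x₂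
  obtain ⟨x₄, h₃₄, h₄⟩ := hR v hv x₃
  exact h₁.trans ((reachable_of_interlaced h₁₂ h₂₃ h₃₄ (h₁.symm.trans h₃)
    (h₂.symm.trans h₄)).trans h₂.symm)

theorem openGraph_restrictHalfPlane_adj (u v : upperHalfPlane) :
    (openGraph (restrictHalfPlane ω)).Adj u v ↔ (openIn ω (above 0)).Adj u v :=
  ⟨fun ⟨h, ho⟩ => ⟨⟨h, ho⟩, u.2, v.2⟩, fun ⟨⟨h, ho⟩, _⟩ => ⟨h, ho⟩⟩

theorem openGraph_restrictHalfPlane_reachable (u v : upperHalfPlane) :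
    (openGraph (restrictHalfPlane ω)).Reachable u v ↔ (openIn ω (above 0)).Reachable u v := by
  constructor
  · rintro ⟨p⟩
    induction p with
    | nil => exact .refl _
    | cons h _ ih => exact ((openGraph_restrictHalfPlane_adj _ _).1 h).reachable.trans ih
  · have key : ∀ a b (p : (openIn ω (above 0)).Walk a b) (ha : a ∈ upperHalfPlane)
        (hb : b ∈ upperHalfPlane),
        (openGraph (restrictHalfPlane ω)).Reachable ⟨a, ha⟩ ⟨b, hb⟩ := by
      intro a b p
      induction p with
      | nil => exact fun _ _ => .refl _
      | @cons a c _ h _ ih =>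
        intro ha hb
        have hadj : (openGraph (restrictHalfPlane ω)).Adj ⟨a, ha⟩ ⟨c, h.2.2⟩ :=
          (openGraph_restrictHalfPlane_adj _ _).2 h
        exact hadj.reachable.trans (ih _ hb)
    exact fun ⟨p⟩ => key _ _ p u.2 v.2

end Deterministic

/-! ### Transfer to the half-plane marginal -/

theorem encard_infiniteClusters_le_one_iff {V : Type} {G : SimpleGraph V} (η : Config G) :
    (infiniteClusters η).encard ≤ 1 ↔
      ∀ u v, ((openGraph η).connectedComponentMk u).supp.Infinite →
        ((openGraph η).connectedComponentMk v).supp.Infinite → (openGraph η).Reachable u v := by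
  rw [Set.encard_le_one_iff]
  constructor
  · exact fun h u v hu hv => SimpleGraph.ConnectedComponent.exact (h _ _ hu hv)
  · intro h C D
    induction C using SimpleGraph.ConnectedComponent.ind
    induction D using SimpleGraph.ConnectedComponent.ind
    exact fun hu hv => SimpleGraph.ConnectedComponent.sound (h _ _ hu hv)

theorem ae_encard_infiniteClusters_halfPlaneMarginal_le_one (μ : Measure (Config squareLattice))
    [IsProbabilityMeasure μ] (hμ : TranslationInvariant μ)
    (hfin : ∀ᵐ ω ∂μ, (infiniteClusters ω).Finite) :
    ∀ᵐ η ∂(halfPlaneMarginal μ), (infiniteClusters η).encard ≤ 1 := by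
  have hmeas : MeasurableSet {η : Config halfPlaneLattice | (infiniteClusters η).encard ≤ 1} := by
    simp only [encard_infiniteClusters_le_one_iff, Set.ofPred_forall]
    refine .iInter fun u => .iInter fun v => ?_
    have hinf := fun w => measurableSet_supp_infinite
      (measurableSet_openGraph_adj (G := halfPlaneLattice)) w
    exact (hinf u).imp ((hinf v).imp (measurableSet_reachable measurableSet_openGraph_adj u v))
  rw [halfPlaneMarginal, ae_map_iff measurable_restrictHalfPlane.aemeasurable hmeas]
  have hlow : ∀ᵐ ω ∂μ, ∀ j, ω ∉ lowestRowEvent j :=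
    ae_all_iff.2 fun j => measure_eq_zero_iff_ae_notMem.1 (measure_lowestRowEvent hμ hfin j)
  have hright : ∀ᵐ ω ∂μ, ∀ x, ω ∉ extremalEvent (0 < ·) x :=
    ae_all_iff.2 fun x => measure_eq_zero_iff_ae_notMem.1
      (measure_extremalEvent hμ hfin (fun d hd => by omega) x)
  have hleft : ∀ᵐ ω ∂μ, ∀ x, ω ∉ extremalEvent (· < 0) x :=
    ae_all_iff.2 fun x => measure_eq_zero_iff_ae_notMem.1
      (measure_extremalEvent hμ hfin (fun d hd => by omega) x)
  filter_upwards [hlow, hright, hleft] with ω h1 h2 h3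
  rw [encard_infiniteClusters_le_one_iff]
  intro u v hu hv
  have hlift : ∀ w : upperHalfPlane,
      ((openGraph (restrictHalfPlane ω)).connectedComponentMk w).supp.Infinite →
      ((openIn ω (above 0)).connectedComponentMk (w : ℤ × ℤ)).supp.Infinite := fun w =>
    supp_infinite_of_reachable_imp Subtype.val_injective
      fun z hz => (openGraph_restrictHalfPlane_reachable w z).1 hz
  exact (openGraph_restrictHalfPlane_reachable u v).2
    (reachable_of_supp_infinite h1 h2 h3 (hlift u hu) (hlift v hv))

end Percolation

theorem lemma2p3 (μ : Measure (Percolation.Config Percolation.squareLattice))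
    [IsProbabilityMeasure μ] (hμ : Percolation.TranslationInvariant μ)
    (hfin : ∀ᵐ ω ∂μ, (Percolation.infiniteClusters ω).Finite) :
    ∀ᵐ η ∂(Percolation.halfPlaneMarginal μ), (Percolation.infiniteClusters η).encard ≤ 1 :=
  Percolation.ae_encard_infiniteClusters_halfPlaneMarginal_le_one μ hμ hfin
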